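/- Let $a>0$, $c>0$, $L_1,L_2,T>0$. Then there are constants $\bar\nu>0$ and $C>0$ (depending only on $a,c,L_1,L_2,T$) such that the following holds for every $0<\nu\le\bar\nu$ and every $g_2\in C_0^\infty((0,T])$, that is, $g_2$ smooth on $(0,T]$ up to $t=T$ with compact support in $(0,T]$. Let $u_2$ be the solution of the advection-diffusion problem $$ \begin{array}{rcll} \partial_t u_2-\nu\,\partial_x^2u_2+a\,\partial_xu_2+c\,u_2&=&0&\text{in }(-L_1,L_2)\times(0,T),\\ u_2(-L_1,\cdot)&=&0&\text{on }(0,T),\\ (\partial_t u_2+a\,\partial_xu_2+c\,u_2)(L_2,\cdot)&=&g_2&\text{on }(0,T),\\ u_2(\cdot,0)&=&0&\text{in }(-L_1,L_2), \end{array} $$ with regularity index $\gamma\in\mathbb N$, meaning that for all $j\le\gamma$ the derivatives $\partial_t^ju_2$, $\partial_t^{j+1}u_2$, $\partial_x\partial_t^ju_2$, $\partial_x^2\partial_t^ju_2$ exist and are continuous on $[-L_1,L_2]\times[0,T]$ (a solution that is $C^\infty$ on the closed rectangle has this regularity for every $\gamma$). Then for every integer $0\le k\le\gamma$, $$ \|\partial_t^ku_2(x,\cdot)\|_{L^2(0,T)}\le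 C\,\nu\,\|g_2\|_{H^k(0,T)}\qquad\text{for all }x\in[-L_1,L_2], $$ and, with $Q=(-L_1,L_2)\times(0,T)$, $$ \|\partial_t^ku_2\|_{L^2(Q)}\le C\nu^{3/2}\|g_2\|_{H^k(0,T)},\quad \|\partial_x\partial_t^ku_2\|_{L^2(Q)}\le C\nu^{1/2}\|g_2\|_{H^k(0,T)},\quad \|\partial_x^2\partial_t^ku_2\|_{L^2(Q)}\le C\nu^{-1/2}\|g_2\|_{H^k(0,T)}. $$ Here $\|g\|_{H^k(0,T)}^2=\sum_{j=0}^k\|g^{(j)}\|_{L^2(0,T)}^2$. -/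

import Mathlib

open Set MeasureTheory
open scoped ENNReal ContDiff

noncomputable section

/-! Functions on `[-L₁, L₂] × [0, T]` are written `u : ℝ → ℝ → ℝ`, with `u x t` the value at the
point `x` and the time `t`. Only the values on that closed rectangle matter; derivatives at its edges
are one-sided. -/

/-- The partial derivative `∂ₜ u` on `[0, T]`. -/
def timeDeriv (T : ℝ) (u : ℝ → ℝ → ℝ) : ℝ → ℝ → ℝ :=
  fun x t => derivWithin (fun s => u x s) (Icc 0 T) t

/-- The partial derivative `∂ₓ u` on `[-L₁, L₂]`. -/
def spaceDeriv (L₁ L₂ : ℝ) (u : ℝ → ℝ → ℝ) : ℝ → ℝ → ℝ :=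
  fun x t => derivWithin (fun y => u y t) (Icc (-L₁) L₂) x

/-- `w`, `∂ₜ w`, `∂ₓ w` and `∂ₓ² w` exist and are continuous on `[-L₁, L₂] × [0, T]`. -/
structure IsParabolicC21 (L₁ L₂ T : ℝ) (w : ℝ → ℝ → ℝ) : Prop where
  diff_t : ∀ x ∈ Icc (-L₁) L₂, DifferentiableOn ℝ (fun t => w x t) (Icc 0 T)
  diff_x : ∀ t ∈ Icc 0 T, DifferentiableOn ℝ (fun x => w x t) (Icc (-L₁) L₂)
  diff_xx : ∀ t ∈ Icc 0 T,
    DifferentiableOn ℝ (fun x => spaceDeriv L₁ L₂ w x t) (Icc (-L₁) L₂)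
  cont : ContinuousOn (fun p : ℝ × ℝ => w p.1 p.2) (Icc (-L₁) L₂ ×ˢ Icc 0 T)
  cont_t : ContinuousOn (fun p : ℝ × ℝ => timeDeriv T w p.1 p.2) (Icc (-L₁) L₂ ×ˢ Icc 0 T)
  cont_x : ContinuousOn (fun p : ℝ × ℝ => spaceDeriv L₁ L₂ w p.1 p.2)
    (Icc (-L₁) L₂ ×ˢ Icc 0 T)
  cont_xx : ContinuousOn (fun p : ℝ × ℝ => spaceDeriv L₁ L₂ (spaceDeriv L₁ L₂ w) p.1 p.2)
    (Icc (-L₁) L₂ ×ˢ Icc 0 T)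

/-- `u` solves the advection-diffusion problem
* `∂ₜ u - ν ∂ₓ² u + a ∂ₓ u + c u = f` in `(-L₁, L₂) × (0, T)`,
* `u(-L₁, ·) = g₁` on `(0, T)`,
* `∂ₜ u + a ∂ₓ u + c u = g₂` at `x = L₂` on `(0, T)` (absorbing boundary condition),
* `u(·, 0) = h` in `(-L₁, L₂)`,

with regularity index `γ`: for every `j ≤ γ`, the derivatives `∂ₜʲ u`, `∂ₜʲ⁺¹ u`, `∂ₓ ∂ₜʲ u` and
`∂ₓ² ∂ₜʲ u` exist and are continuous up to the boundary. -/
structure IsAdvDiffSolution (a c ν L₁ L₂ T : ℝ) (f : ℝ → ℝ → ℝ) (g₁ g₂ : ℝ → ℝ) (h : ℝ → ℝ)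
    (γ : ℕ) (u : ℝ → ℝ → ℝ) : Prop where
  regular : ∀ j ≤ γ, IsParabolicC21 L₁ L₂ T ((timeDeriv T)^[j] u)
  equation : ∀ x ∈ Ioo (-L₁) L₂, ∀ t ∈ Ioo 0 T,
    timeDeriv T u x t - ν * spaceDeriv L₁ L₂ (spaceDeriv L₁ L₂ u) x t
      + a * spaceDeriv L₁ L₂ u x t + c * u x t = f x t
  left : ∀ t ∈ Ioo 0 T, u (-L₁) t = g₁ t
  right : ∀ t ∈ Ioo 0 T,
    timeDeriv T u L₂ t + a * spaceDeriv L₁ L₂ u L₂ t + c * u L₂ t = g₂ t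
  initial : ∀ x ∈ Ioo (-L₁) L₂, u x 0 = h x

/-- `g ∈ C₀^∞((0, T])`: smooth on `(0, T]` (up to `T`), with compact support in `(0, T]`. -/
def IsSmoothCompactIoc (T : ℝ) (g : ℝ → ℝ) : Prop :=
  ContDiffOn ℝ ∞ g (Ioc 0 T) ∧
    ∃ K : Set ℝ, IsCompact K ∧ K ⊆ Ioc 0 T ∧ ∀ t ∈ Ioc 0 T, t ∉ K → g t = 0

/-- The norm of `L²(0, T)`. -/
def normL2t (T : ℝ) (g : ℝ → ℝ) : ℝ≥0∞ :=
  eLpNorm g 2 (volume.restrict (Ioo 0 T))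

/-- The norm of `L²((-L₁, L₂) × (0, T))`. -/
def normL2xt (L₁ L₂ T : ℝ) (w : ℝ → ℝ → ℝ) : ℝ≥0∞ :=
  eLpNorm (fun p : ℝ × ℝ => w p.1 p.2) 2 (volume.restrict (Ioo (-L₁) L₂ ×ˢ Ioo 0 T))

/-- The norm of `Hᵏ(0, T)` (for functions that are smooth on `(0, T]`),
`(∑_{j ≤ k} ‖g⁽ʲ⁾‖²_{L²(0, T)})^{1/2}`. -/
def normHt (T : ℝ) (k : ℕ) (g : ℝ → ℝ) : ℝ≥0∞ :=
  (∑ j ∈ Finset.range (k + 1),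
    normL2t T (iteratedDerivWithin j g (Ioc 0 T)) ^ 2) ^ (1 / 2 : ℝ)

end

/-!
All bounds come from energy identities for one function `w = ∂ₜᵏ u`. It solves the homogeneous
equation with zero initial and inflow data, and at the outflow point
`∂ₜ w + a ∂ₓ w + c w = g` with `g` the `k`-th derivative of the datum
(`IsAdvDiffSolution.isExtendedSolution`, `IsAdvDiffSolution.iteratedDerivWithin_eq`).
So only `N = ‖g‖²` in `L²(0, T)` enters, and `normHt` is used through its top term.

* Test the equation with `w` on `(-L₁, X) × (0, T)` and put `m(X) = ∫₀ᵀ w(X, t)² dt`. The result,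
  `(a / 2) m(X) + ν ∬ (∂ₓ w)² ≤ ν ∫₀ᵀ w ∂ₓ w (X, t) dt = (ν / 2) m'(X)`, says that
  `m(X) exp (-a X / ν)` increases, so that `m(X) ≤ exp (-a (L₂ - X) / ν) m(L₂)`: the solution lives
  in a layer of width `ν / a` at the outflow point (`energy_le`, `integral_sq_le_exp`).
* For `X = L₂` the boundary condition turns the right-hand side into
  `(ν / a) ∫ g w - (ν / a) ∫ (w ∂ₜ w + c w²) ≤ (ν / a) ∫ g w`, hence `m(L₂) ≤ 4 ν² N / a⁴` and
  `∬ (∂ₓ w)² ≤ ν N / (2 a³)` (`outflow_energy_le`). Integrating the exponential decay in `X` gains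
  another factor `ν / a` for `∬ w²` (`integral_integral_sq_le`).
* Test the equation with `∂ₜ w`. The boundary term `ν ∫ ∂ₓ w ∂ₜ w (L₂, t) dt` is at most
  `ν N / (4 a)`, again by the boundary condition, which gives `∬ (∂ₜ w)² ≤ ν N / a`; the equation
  then bounds `ν ∂ₓ² w` (`setIntegral_wt_sq_le`, `setIntegral_wxx_sq_le`). Here
  `-∬ ∂ₓ² w ∂ₜ w` has to be integrated by parts although `∂ₜ ∂ₓ w` need not exist
  (`hasDerivAt_integral_wx_sq`).
-/

/-! ### Calculus of continuous functions of two variables -/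

theorem hasDerivAt_intervalIntegral_param {F f : ℝ → ℝ → ℝ} {A B : ℝ} (a b : ℝ)
    (hF : Continuous fun p : ℝ × ℝ => F p.1 p.2) (hf : Continuous fun p : ℝ × ℝ => f p.1 p.2)
    (hd : ∀ x ∈ Ioo A B, ∀ t, HasDerivAt (fun y => F y t) (f x t) x) {x : ℝ}
    (hx : x ∈ Ioo A B) :
    HasDerivAt (fun y => ∫ t in a..b, F y t) (∫ t in a..b, f x t) x := by
  obtain ⟨M, hM⟩ := ((isCompact_Icc (a := A) (b := B)).prod
    (isCompact_uIcc (a := a) (b := b))).exists_bound_of_continuousOn hf.continuousOn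
  refine (intervalIntegral.hasDerivAt_integral_of_dominated_loc_of_deriv_le
    (bound := fun _ => M) (s := Ioo A B) (Ioo_mem_nhds hx.1 hx.2) ?_ ?_ ?_ ?_ ?_ ?_).2
  · exact Filter.Eventually.of_forall fun y =>
      Continuous.aestronglyMeasurable (by fun_prop)
  · exact Continuous.intervalIntegrable (by fun_prop) _ _
  · exact Continuous.aestronglyMeasurable (by fun_prop)
  · exact Filter.Eventually.of_forall fun t ht y hy =>
      hM (y, t) ⟨Ioo_subset_Icc_self hy, uIoc_subset_uIcc ht⟩
  · exact intervalIntegrable_const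
  · exact Filter.Eventually.of_forall fun t _ y hy => hd y hy t

theorem intervalIntegral_eq_sub_of_continuous {f f' : ℝ → ℝ} {a b : ℝ} (hab : a ≤ b)
    (hf : Continuous f) (hf' : Continuous f') (hd : ∀ x ∈ Ioo a b, HasDerivAt f (f' x) x) :
    ∫ x in a..b, f' x = f b - f a :=
  intervalIntegral.integral_eq_sub_of_hasDerivAt_of_le hab hf.continuousOn hd
    (hf'.intervalIntegrable _ _)

theorem integrableOn_Ioo_prod_of_continuous {f : ℝ → ℝ → ℝ}
    (hf : Continuous fun p : ℝ × ℝ => f p.1 p.2) (a b c d : ℝ) :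
    IntegrableOn (fun p : ℝ × ℝ => f p.1 p.2) (Ioo a b ×ˢ Ioo c d) :=
  (hf.continuousOn.integrableOn_compact (isCompact_Icc.prod isCompact_Icc)).mono_set
    (prod_mono Ioo_subset_Icc_self Ioo_subset_Icc_self)

theorem setIntegral_Ioo_prod_of_continuous {f : ℝ → ℝ → ℝ}
    (hf : Continuous fun p : ℝ × ℝ => f p.1 p.2) {a b c d : ℝ} (hab : a ≤ b) (hcd : c ≤ d) :
    ∫ p in Ioo a b ×ˢ Ioo c d, f p.1 p.2 = ∫ x in a..b, ∫ y in c..d, f x y := by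
  rw [Measure.volume_eq_prod,
    setIntegral_prod _ (integrableOn_Ioo_prod_of_continuous hf a b c d),
    intervalIntegral.integral_of_le hab, ← integral_Ioc_eq_integral_Ioo]
  simp only [intervalIntegral.integral_of_le hcd, integral_Ioc_eq_integral_Ioo]

theorem intervalIntegral_swap_of_continuous {f : ℝ → ℝ → ℝ}
    (hf : Continuous fun p : ℝ × ℝ => f p.1 p.2) {a b c d : ℝ} (hab : a ≤ b) (hcd : c ≤ d) :
    ∫ x in a..b, ∫ y in c..d, f x y = ∫ y in c..d, ∫ x in a..b, f x y := by
  have h1 := integrableOn_Ioo_prod_of_continuous hf a b c d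
  rw [IntegrableOn, Measure.volume_eq_prod, ← Measure.prod_restrict] at h1
  have h2 := integral_integral_swap (f := f) h1
  simpa only [intervalIntegral.integral_of_le hab, intervalIntegral.integral_of_le hcd,
    integral_Ioc_eq_integral_Ioo] using h2

theorem continuous_intervalIntegral_param {f : ℝ → ℝ → ℝ}
    (hf : Continuous fun p : ℝ × ℝ => f p.1 p.2) (a b : ℝ) :
    Continuous fun x => ∫ y in a..b, f x y :=
  intervalIntegral.continuous_parametric_intervalIntegral_of_continuous' hf a b

/-! ### Energy estimates -/

/-- `w` solves the homogeneous advection-diffusion equation with zero inflow and initial data, and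
`wt`, `wx`, `wxx` are its derivatives `∂ₜ w`, `∂ₓ w`, `∂ₓ² w`. All four are continuous functions on
the whole plane, to be thought of as extended from the rectangle `[-L₁, L₂] × [0, T]` by
`clampRect`: this is why the equation and the data are required at all points, while the derivatives
are only prescribed in the variable that runs through the open interval. There is no condition at
`x = L₂`; the estimates are in terms of the outflow datum `wt + a * wx + c * w` at `L₂`. -/
structure IsExtendedSolution (a c ν L₁ L₂ T : ℝ) (w wt wx wxx : ℝ → ℝ → ℝ) : Prop where
  cont : Continuous fun p : ℝ × ℝ => w p.1 p.2
  cont_t : Continuous fun p : ℝ × ℝ => wt p.1 p.2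
  cont_x : Continuous fun p : ℝ × ℝ => wx p.1 p.2
  cont_xx : Continuous fun p : ℝ × ℝ => wxx p.1 p.2
  deriv_t : ∀ x, ∀ t ∈ Ioo 0 T, HasDerivAt (fun s => w x s) (wt x t) t
  deriv_x : ∀ x ∈ Ioo (-L₁) L₂, ∀ t, HasDerivAt (fun y => w y t) (wx x t) x
  deriv_xx : ∀ x ∈ Ioo (-L₁) L₂, ∀ t, HasDerivAt (fun y => wx y t) (wxx x t) x
  equation : ∀ x t, wt x t - ν * wxx x t + a * wx x t + c * w x t = 0
  left : ∀ t, w (-L₁) t = 0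
  initial : ∀ x, w x 0 = 0

namespace IsExtendedSolution
variable {a c ν L₁ L₂ T : ℝ} {w wt wx wxx : ℝ → ℝ → ℝ}

theorem left_t (h : IsExtendedSolution a c ν L₁ L₂ T w wt wx wxx) {t : ℝ} (ht : t ∈ Ioo 0 T) :
    wt (-L₁) t = 0 := by
  have h1 := h.deriv_t (-L₁) t ht
  simp only [h.left] at h1
  exact h1.unique (hasDerivAt_const t (0 : ℝ))

theorem initial_x (h : IsExtendedSolution a c ν L₁ L₂ T w wt wx wxx) {x : ℝ}
    (hx : x ∈ Ioo (-L₁) L₂) : wx x 0 = 0 := by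
  have h1 := h.deriv_x x hx 0
  simp only [h.initial] at h1
  exact h1.unique (hasDerivAt_const x (0 : ℝ))

theorem initial_xx (h : IsExtendedSolution a c ν L₁ L₂ T w wt wx wxx) {x : ℝ}
    (hx : x ∈ Ioo (-L₁) L₂) : wxx x 0 = 0 := by
  refine (h.deriv_xx x hx 0).unique ((hasDerivAt_const x (0 : ℝ)).congr_of_eventuallyEq ?_)
  filter_upwards [Ioo_mem_nhds hx.1 hx.2] with y hy using h.initial_x hy

/-- The energy identity at a fixed time: the equation, multiplied by `w` and integrated over
`(-L₁, X)`. -/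
theorem energy_slice (h : IsExtendedSolution a c ν L₁ L₂ T w wt wx wxx) {X : ℝ}
    (hX : X ∈ Icc (-L₁) L₂) (t : ℝ) :
    ν * (w X t * wx X t) = (∫ x in (-L₁)..X, w x t * wt x t) + ν * (∫ x in (-L₁)..X, wx x t ^ 2)
      + c * (∫ x in (-L₁)..X, w x t ^ 2) + a / 2 * w X t ^ 2 := by
  have h0 := h.cont
  have h1 := h.cont_t
  have h2 := h.cont_x
  have h3 := h.cont_xx
  have e1 := intervalIntegral_eq_sub_of_continuous (f := fun x => w x t * wx x t)
    (f' := fun x => wx x t * wx x t + w x t * wxx x t) hX.1 (by fun_prop) (by fun_prop)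
    (fun x hx => (h.deriv_x x ⟨hx.1, hx.2.trans_le hX.2⟩ t).mul
      (h.deriv_xx x ⟨hx.1, hx.2.trans_le hX.2⟩ t))
  have e2 := intervalIntegral_eq_sub_of_continuous (f := fun x => w x t ^ 2)
    (f' := fun x => 2 * (w x t * wx x t)) hX.1 (by fun_prop) (by fun_prop)
    (fun x hx => by
      have := (h.deriv_x x ⟨hx.1, hx.2.trans_le hX.2⟩ t).pow 2
      exact this.congr_deriv (by norm_num; ring))
  simp only [h.left, zero_mul, sub_zero, ne_eq, OfNat.ofNat_ne_zero, not_false_eq_true, zero_pow]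
    at e1 e2
  rw [← e1, ← e2, ← intervalIntegral.integral_const_mul, ← intervalIntegral.integral_const_mul,
    ← intervalIntegral.integral_const_mul, ← intervalIntegral.integral_const_mul,
    ← intervalIntegral.integral_add, ← intervalIntegral.integral_add,
    ← intervalIntegral.integral_add]
  · congr 1
    ext x
    linear_combination (-w x t) * h.equation x t
  all_goals exact Continuous.intervalIntegrable (by fun_prop) _ _

theorem intervalIntegral_mul_wt_nonneg (h : IsExtendedSolution a c ν L₁ L₂ T w wt wx wxx)
    (hT : 0 ≤ T) (x : ℝ) : 0 ≤ ∫ t in 0..T, w x t * wt x t := by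
  have h0 := h.cont
  have h1 := h.cont_t
  rw [intervalIntegral_eq_sub_of_continuous (f := fun t => w x t ^ 2 / 2)
    (f' := fun t => w x t * wt x t) hT (by fun_prop) (by fun_prop)
    (fun t ht => (((h.deriv_t x t ht).pow 2).div_const 2).congr_deriv (by norm_num; ring)),
    h.initial]
  have := sq_nonneg (w x T)
  simp only [ne_eq, OfNat.ofNat_ne_zero, not_false_eq_true, zero_pow, zero_div, sub_zero]
  positivity

theorem integral_mul_wt_nonneg (h : IsExtendedSolution a c ν L₁ L₂ T w wt wx wxx) (hT : 0 ≤ T)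
    {X : ℝ} (hX : -L₁ ≤ X) : 0 ≤ ∫ t in 0..T, ∫ x in (-L₁)..X, w x t * wt x t := by
  have h0 := h.cont
  have h1 := h.cont_t
  rw [← intervalIntegral_swap_of_continuous (f := fun x t => w x t * wt x t) (by fun_prop) hX hT]
  exact intervalIntegral.integral_nonneg hX fun x _ => h.intervalIntegral_mul_wt_nonneg hT x

theorem energy_le (h : IsExtendedSolution a c ν L₁ L₂ T w wt wx wxx) (hc : 0 ≤ c) (hT : 0 ≤ T)
    {X : ℝ} (hX : X ∈ Icc (-L₁) L₂) :
    ν * (∫ t in 0..T, ∫ x in (-L₁)..X, wx x t ^ 2) + a / 2 * (∫ t in 0..T, w X t ^ 2)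
      ≤ ν * ∫ t in 0..T, w X t * wx X t := by
  have h0 := h.cont
  have h1 := h.cont_t
  have h2 := h.cont_x
  have n1 := h.integral_mul_wt_nonneg hT hX.1
  have n2 : 0 ≤ ∫ t in 0..T, ∫ x in (-L₁)..X, w x t ^ 2 :=
    intervalIntegral.integral_nonneg hT fun t _ =>
      intervalIntegral.integral_nonneg hX.1 fun x _ => sq_nonneg _
  have c1 := continuous_intervalIntegral_param (f := fun t x => w x t * wt x t) (by fun_prop)
    (-L₁) X
  have e : ν * (∫ t in 0..T, w X t * wx X t)
      = (∫ t in 0..T, ∫ x in (-L₁)..X, w x t * wt x t)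
        + ν * (∫ t in 0..T, ∫ x in (-L₁)..X, wx x t ^ 2)
        + c * (∫ t in 0..T, ∫ x in (-L₁)..X, w x t ^ 2) + a / 2 * (∫ t in 0..T, w X t ^ 2) := by
    simp only [← intervalIntegral.integral_const_mul ν, ← intervalIntegral.integral_const_mul c,
      ← intervalIntegral.integral_const_mul (a / 2)]
    rw [← intervalIntegral.integral_add, ← intervalIntegral.integral_add,
      ← intervalIntegral.integral_add]
    · congr 1
      ext t
      simp only [intervalIntegral.integral_const_mul]
      exact h.energy_slice hX t
    all_goals
      try simp only [intervalIntegral.integral_const_mul]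
      exact Continuous.intervalIntegrable (by fun_prop) _ _
  nlinarith [mul_nonneg hc n2]

/-- `energy_le` bounds `∫ w(X, t)² dt` by `ν / a` times its derivative in `X`, so it decays
exponentially away from the outflow point. -/
theorem integral_sq_le_exp (h : IsExtendedSolution a c ν L₁ L₂ T w wt wx wxx) (hc : 0 ≤ c)
    (hν : 0 < ν) (hT : 0 ≤ T) {X : ℝ} (hX : X ∈ Icc (-L₁) L₂) :
    ∫ t in 0..T, w X t ^ 2 ≤ Real.exp (-(a / ν) * (L₂ - X)) * ∫ t in 0..T, w L₂ t ^ 2 := by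
  have h0 := h.cont
  have h2 := h.cont_x
  have hd : ∀ x ∈ Ioo (-L₁) L₂, HasDerivAt
      (fun x => Real.exp (-(a / ν) * x) * ∫ t in 0..T, w x t ^ 2)
      (Real.exp (-(a / ν) * x) * (-(a / ν)) * (∫ t in 0..T, w x t ^ 2)
        + Real.exp (-(a / ν) * x) * ∫ t in 0..T, 2 * (w x t * wx x t)) x := by
    intro x hx
    refine HasDerivAt.mul ?_ ?_
    · simpa using ((hasDerivAt_id x).const_mul (-(a / ν))).exp
    · refine hasDerivAt_intervalIntegral_param (F := fun x t => w x t ^ 2)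
        (f := fun x t => 2 * (w x t * wx x t)) 0 T (by fun_prop) (by fun_prop) ?_ hx
      intro x hx t
      have := (h.deriv_x x hx t).pow 2
      exact this.congr_deriv (by norm_num; ring)
  -- Multiplied by the integrating factor, the integral over time increases with `x`.
  have hm : MonotoneOn (fun x => Real.exp (-(a / ν) * x) * ∫ t in 0..T, w x t ^ 2)
      (Icc (-L₁) L₂) := by
    refine monotoneOn_of_deriv_nonneg (convex_Icc _ _) (by fun_prop) ?_ ?_
    · rw [interior_Icc]
      exact fun x hx => (hd x hx).differentiableAt.differentiableWithinAt
    · rw [interior_Icc]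
      intro x hx
      have e := h.energy_le hc hT (Ioo_subset_Icc_self hx)
      have n2 : 0 ≤ ∫ t in 0..T, ∫ y in (-L₁)..x, wx y t ^ 2 :=
        intervalIntegral.integral_nonneg hT fun t _ =>
          intervalIntegral.integral_nonneg hx.1.le fun x _ => sq_nonneg _
      rw [(hd x hx).deriv, intervalIntegral.integral_const_mul, mul_assoc, ← mul_add]
      refine mul_nonneg (Real.exp_pos _).le ?_
      have e' : a / 2 * (∫ t in 0..T, w x t ^ 2) ≤ ν * ∫ t in 0..T, w x t * wx x t := by
        nlinarith [mul_nonneg hν.le n2]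
      have : a / ν * (∫ t in 0..T, w x t ^ 2) ≤ 2 * ∫ t in 0..T, w x t * wx x t := by
        rw [div_mul_eq_mul_div, div_le_iff₀ hν]
        linarith
      linarith
  have := hm hX (right_mem_Icc.2 (hX.1.trans hX.2)) hX.2
  have e2 : Real.exp (-(a / ν) * (L₂ - X))
      = Real.exp (-(a / ν) * L₂) * (Real.exp (-(a / ν) * X))⁻¹ := by
    rw [← Real.exp_neg, ← Real.exp_add]
    congr 1; ring
  rw [e2, mul_right_comm, ← div_eq_mul_inv, le_div_iff₀ (Real.exp_pos _), mul_comm]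
  exact this

/-- The energy estimate on the whole rectangle, where the flux `wx L₂` is eliminated by means of the
outflow datum and Young's inequality with weight `ε` absorbs the resulting product. The choice
`ε = a / 2` gives the bound of `wx`, the choice `ε = a / 4` that of `w L₂`. -/
theorem outflow_energy_le (h : IsExtendedSolution a c ν L₁ L₂ T w wt wx wxx) (ha : 0 < a)
    (hc : 0 ≤ c) (hν : 0 < ν) (hT : 0 ≤ T) (hL : -L₁ ≤ L₂) {ε : ℝ} (hε : 0 < ε) :
    ν * (∫ t in 0..T, ∫ x in (-L₁)..L₂, wx x t ^ 2) + (a / 2 - ε) * (∫ t in 0..T, w L₂ t ^ 2)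
      ≤ ν ^ 2 / (4 * ε * a ^ 2) *
        ∫ t in 0..T, (wt L₂ t + a * wx L₂ t + c * w L₂ t) ^ 2 := by
  have h0 := h.cont
  have h1 := h.cont_t
  have h2 := h.cont_x
  have e := h.energy_le hc hT (right_mem_Icc.2 hL)
  have n1 := h.intervalIntegral_mul_wt_nonneg hT L₂
  have e2 : ν * (∫ t in 0..T, w L₂ t * wx L₂ t) + ν / a * (∫ t in 0..T, w L₂ t * wt L₂ t) ≤
      ε * (∫ t in 0..T, w L₂ t ^ 2) + ν ^ 2 / (4 * ε * a ^ 2) *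
        ∫ t in 0..T, (wt L₂ t + a * wx L₂ t + c * w L₂ t) ^ 2 := by
    simp only [← intervalIntegral.integral_const_mul]
    rw [← intervalIntegral.integral_add, ← intervalIntegral.integral_add]
    · refine intervalIntegral.integral_mono hT ?_ ?_ fun t => ?_
      · exact Continuous.intervalIntegrable (by fun_prop) _ _
      · exact Continuous.intervalIntegrable (by fun_prop) _ _
      · have k1 : 0 ≤ ν / a * c * w L₂ t ^ 2 := by positivity
        have k3 : ε * w L₂ t ^ 2 + ν ^ 2 / (4 * ε * a ^ 2) *
            (wt L₂ t + a * wx L₂ t + c * w L₂ t) ^ 2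
            - (ν * (w L₂ t * wx L₂ t) + ν / a * (w L₂ t * wt L₂ t))
            = ν / a * c * w L₂ t ^ 2 +
              (2 * ε * a * w L₂ t - ν * (wt L₂ t + a * wx L₂ t + c * w L₂ t)) ^ 2
                / (4 * ε * a ^ 2) := by
          field_simp
          ring
        have k4 : 0 ≤ (2 * ε * a * w L₂ t - ν * (wt L₂ t + a * wx L₂ t + c * w L₂ t)) ^ 2
                / (4 * ε * a ^ 2) := by positivity
        linarith
    all_goals exact Continuous.intervalIntegrable (by fun_prop) _ _
  have : 0 ≤ ν / a * (∫ t in 0..T, w L₂ t * wt L₂ t) := mul_nonneg (by positivity) n1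
  linarith

theorem integral_wx_sq_le (h : IsExtendedSolution a c ν L₁ L₂ T w wt wx wxx) (ha : 0 < a)
    (hc : 0 ≤ c) (hν : 0 < ν) (hT : 0 ≤ T) (hL : -L₁ ≤ L₂) :
    (∫ t in 0..T, ∫ x in (-L₁)..L₂, wx x t ^ 2) ≤ ν / (2 * a ^ 3) *
        ∫ t in 0..T, (wt L₂ t + a * wx L₂ t + c * w L₂ t) ^ 2 := by
  have := h.outflow_energy_le ha hc hν hT hL (half_pos ha)
  rw [sub_self, zero_mul, add_zero] at this
  refine le_of_mul_le_mul_left (this.trans_eq ?_) hν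
  field_simp
  ring

theorem integral_sq_le (h : IsExtendedSolution a c ν L₁ L₂ T w wt wx wxx) (ha : 0 < a) (hc : 0 ≤ c)
    (hν : 0 < ν) (hT : 0 ≤ T) {X : ℝ} (hX : X ∈ Icc (-L₁) L₂) :
    ∫ t in 0..T, w X t ^ 2 ≤ Real.exp (-(a / ν) * (L₂ - X)) * (4 * ν ^ 2 / a ^ 4 *
        ∫ t in 0..T, (wt L₂ t + a * wx L₂ t + c * w L₂ t) ^ 2) := by
  have hL := hX.1.trans hX.2
  refine (h.integral_sq_le_exp hc hν hT hX).trans ?_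
  gcongr
  have := h.outflow_energy_le ha hc hν hT hL (ε := a / 4) (by positivity)
  have n2 : 0 ≤ ν * ∫ t in 0..T, ∫ x in (-L₁)..L₂, wx x t ^ 2 :=
    mul_nonneg hν.le <| intervalIntegral.integral_nonneg hT fun t _ =>
      intervalIntegral.integral_nonneg hL fun x _ => sq_nonneg _
  have h4 : 0 < a / 4 := by positivity
  refine le_of_mul_le_mul_left (a := a / 4) ?_ h4
  have e : a / 4 * (4 * ν ^ 2 / a ^ 4 *
        ∫ t in 0..T, (wt L₂ t + a * wx L₂ t + c * w L₂ t) ^ 2) = ν ^ 2 / (4 * (a / 4) * a ^ 2) *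
        ∫ t in 0..T, (wt L₂ t + a * wx L₂ t + c * w L₂ t) ^ 2 := by
    field_simp
  linarith

theorem integral_integral_sq_le (h : IsExtendedSolution a c ν L₁ L₂ T w wt wx wxx) (ha : 0 < a)
    (hc : 0 ≤ c) (hν : 0 < ν) (hT : 0 ≤ T) (hL : -L₁ ≤ L₂) :
    ∫ x in (-L₁)..L₂, ∫ t in 0..T, w x t ^ 2 ≤ 4 * ν ^ 3 / a ^ 5 *
        ∫ t in 0..T, (wt L₂ t + a * wx L₂ t + c * w L₂ t) ^ 2 := by
  have h0 := h.cont
  set N := ∫ t in 0..T, (wt L₂ t + a * wx L₂ t + c * w L₂ t) ^ 2 with hN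
  have hN0 : 0 ≤ N := intervalIntegral.integral_nonneg hT fun t _ => sq_nonneg _
  have c1 := continuous_intervalIntegral_param (f := fun x t => w x t ^ 2) (by fun_prop) 0 T
  have hr : a / ν ≠ 0 := by positivity
  have e : ∫ x in (-L₁)..L₂, Real.exp (-(a / ν) * (L₂ - x))
      = ν / a - ν / a * Real.exp (-(a / ν) * (L₂ - -L₁)) := by
    rw [intervalIntegral_eq_sub_of_continuous (f := fun x => ν / a * Real.exp (-(a / ν) * (L₂ - x)))
      hL (by fun_prop) (by fun_prop)]
    · simp
    · intro x _
      have := ((((hasDerivAt_id x).const_sub L₂).const_mul (-(a / ν))).exp).const_mul (ν / a)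
      exact this.congr_deriv (by simp only [id]; field_simp)
  calc ∫ x in (-L₁)..L₂, ∫ t in 0..T, w x t ^ 2
      ≤ ∫ x in (-L₁)..L₂, Real.exp (-(a / ν) * (L₂ - x)) * (4 * ν ^ 2 / a ^ 4 * N) := by
        refine intervalIntegral.integral_mono_on hL (c1.intervalIntegrable _ _)
          (Continuous.intervalIntegrable (by fun_prop) _ _) fun x hx => ?_
        exact h.integral_sq_le ha hc hν hT hx
    _ = (ν / a - ν / a * Real.exp (-(a / ν) * (L₂ - -L₁))) * (4 * ν ^ 2 / a ^ 4 * N) := by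
        rw [intervalIntegral.integral_mul_const, e]
    _ ≤ ν / a * (4 * ν ^ 2 / a ^ 4 * N) := by
        gcongr
        have : 0 ≤ ν / a * Real.exp (-(a / ν) * (L₂ - -L₁)) := by positivity
        linarith
    _ = 4 * ν ^ 3 / a ^ 5 * N := by field_simp

/-- The derivative of `∫ wx² dx` in time, without a mixed derivative `∂ₜ ∂ₓ w`. Integrating by
parts, `∫ (wx(s)² - wx(t)²) = [(wx(s) + wx(t)) (w(s) - w(t))] - ∫ (wxx(s) + wxx(t)) (w(s) - w(t))`,
and only `w` is differentiated in time on the right. -/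
theorem hasDerivAt_integral_wx_sq (h : IsExtendedSolution a c ν L₁ L₂ T w wt wx wxx) (hL : -L₁ ≤ L₂)
    {t : ℝ} (ht : t ∈ Ioo 0 T) :
    HasDerivAt (fun s => ∫ x in (-L₁)..L₂, wx x s ^ 2)
      (2 * (wx L₂ t * wt L₂ t) - ∫ x in (-L₁)..L₂, 2 * (wxx x t * wt x t)) t := by
  have h0 := h.cont
  have h1 := h.cont_t
  have h2 := h.cont_x
  have h3 := h.cont_xx
  -- `D x s` is the difference quotient of `w x` at `t`, in a form that is continuous at `s = t`.
  set D : ℝ → ℝ → ℝ := fun x s => ∫ θ in (0 : ℝ)..1, wt x (t + θ * (s - t)) with hD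
  have hDc : Continuous fun p : ℝ × ℝ => D p.1 p.2 :=
    intervalIntegral.continuous_parametric_intervalIntegral_of_continuous'
      (f := fun (p : ℝ × ℝ) θ => wt p.1 (t + θ * (p.2 - t))) (by fun_prop) 0 1
  have hDt : ∀ x, D x t = wt x t := fun x => by simp [hD]
  have hw : ∀ s ∈ Ioo 0 T, ∀ x, w x s - w x t = (s - t) * D x s := by
    intro s hs x
    have := intervalIntegral_eq_sub_of_continuous (a := 0) (b := 1)
      (f := fun θ => w x (t + θ * (s - t))) (f' := fun θ => wt x (t + θ * (s - t)) * (s - t))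
      zero_le_one (by fun_prop) (by fun_prop) (fun θ hθ => by
        have hm : t + θ * (s - t) ∈ Ioo 0 T := by
          have := (convex_Ioo 0 T) ht hs (a := 1 - θ) (b := θ) (by linarith [hθ.2]) hθ.1.le
            (by ring)
          convert this using 1
          simp only [smul_eq_mul]
          ring
        have := ((hasDerivAt_id θ).mul_const (s - t)).const_add t
        rw [one_mul] at this
        exact HasDerivAt.comp (h₂ := fun r => w x r) θ (h.deriv_t x _ hm) this)
    rw [intervalIntegral.integral_mul_const] at this
    simp only [one_mul, add_sub_cancel, zero_mul, add_zero] at this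
    rw [← this, mul_comm]
  have hE : ∀ s ∈ Ioo 0 T, (∫ x in (-L₁)..L₂, wx x s ^ 2) - (∫ x in (-L₁)..L₂, wx x t ^ 2)
      = (s - t) * ((wx L₂ s + wx L₂ t) * D L₂ s
        - ∫ x in (-L₁)..L₂, (wxx x s + wxx x t) * D x s) := by
    intro s hs
    have e := intervalIntegral_eq_sub_of_continuous
      (f := fun x => (wx x s + wx x t) * (w x s - w x t))
      (f' := fun x => (wxx x s + wxx x t) * (w x s - w x t)
        + (wx x s + wx x t) * (wx x s - wx x t)) hL (by fun_prop) (by fun_prop)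
      (fun x hx => ((h.deriv_xx x hx s).add (h.deriv_xx x hx t)).mul
        ((h.deriv_x x hx s).sub (h.deriv_x x hx t)))
    rw [intervalIntegral.integral_add
      (Continuous.intervalIntegrable (by fun_prop) _ _)
      (Continuous.intervalIntegrable (by fun_prop) _ _)] at e
    simp only [h.left, sub_self, mul_zero, sub_zero] at e
    simp only [hw s hs] at e
    rw [← intervalIntegral.integral_sub (Continuous.intervalIntegrable (by fun_prop) _ _)
      (Continuous.intervalIntegrable (by fun_prop) _ _), mul_sub,
      ← intervalIntegral.integral_const_mul (s - t) (fun x => (wxx x s + wxx x t) * D x s)]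
    have e1 : ∀ x, (s - t) * ((wxx x s + wxx x t) * D x s)
        = (wxx x s + wxx x t) * ((s - t) * D x s) := fun x => by ring
    have e2 : ∀ x, wx x s ^ 2 - wx x t ^ 2 = (wx x s + wx x t) * (wx x s - wx x t) :=
      fun x => by ring
    simp only [e1, e2]
    linarith
  have hc := continuous_intervalIntegral_param
    (f := fun s x => (wxx x s + wxx x t) * D x s) (by fun_prop) (-L₁) L₂
  have hlim : Continuous fun s => (wx L₂ s + wx L₂ t) * D L₂ s
        - ∫ x in (-L₁)..L₂, (wxx x s + wxx x t) * D x s := by fun_prop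
  rw [hasDerivAt_iff_tendsto_slope]
  have hl := (hlim.tendsto t).mono_left (nhdsWithin_le_nhds (s := {t}ᶜ))
  simp only [hDt, ← two_mul, mul_assoc] at hl
  refine hl.congr' ?_
  filter_upwards [nhdsWithin_le_nhds (Ioo_mem_nhds ht.1 ht.2), self_mem_nhdsWithin] with s hs hst
  have hst' : s - t ≠ 0 := sub_ne_zero.2 hst
  rw [slope_def_field, hE s hs, mul_div_cancel_left₀ _ hst']

theorem integral_wxx_mul_wt_le (h : IsExtendedSolution a c ν L₁ L₂ T w wt wx wxx) (hL : -L₁ ≤ L₂)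
    (hT : 0 ≤ T) :
    ∫ t in 0..T, ∫ x in (-L₁)..L₂, wxx x t * wt x t ≤ ∫ t in 0..T, wx L₂ t * wt L₂ t := by
  have h1 := h.cont_t
  have h2 := h.cont_x
  have h3 := h.cont_xx
  have c1 := continuous_intervalIntegral_param (f := fun t x => wx x t ^ 2) (by fun_prop) (-L₁) L₂
  have c2 := continuous_intervalIntegral_param (f := fun t x => 2 * (wxx x t * wt x t))
    (by fun_prop) (-L₁) L₂
  have e := intervalIntegral_eq_sub_of_continuous hT c1 (by fun_prop)
    (fun t ht => h.hasDerivAt_integral_wx_sq hL ht)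
  have z : ∫ x in (-L₁)..L₂, wx x 0 ^ 2 = 0 := by
    rw [intervalIntegral.integral_of_le hL, integral_Ioc_eq_integral_Ioo]
    exact setIntegral_eq_zero_of_forall_eq_zero fun x hx => by simp [h.initial_x hx]
  have p : 0 ≤ ∫ x in (-L₁)..L₂, wx x T ^ 2 :=
    intervalIntegral.integral_nonneg hL fun x _ => sq_nonneg _
  rw [z, intervalIntegral.integral_sub (Continuous.intervalIntegrable (by fun_prop) _ _)
    (c2.intervalIntegrable _ _)] at e
  simp only [intervalIntegral.integral_const_mul] at e
  linarith

theorem setIntegral_wt_sq_le (h : IsExtendedSolution a c ν L₁ L₂ T w wt wx wxx) (ha : 0 < a)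
    (hc : 0 ≤ c) (hν : 0 < ν) (hT : 0 ≤ T) (hL : -L₁ ≤ L₂) :
    ∫ p in Ioo (-L₁) L₂ ×ˢ Ioo 0 T, wt p.1 p.2 ^ 2 ≤ ν / a *
        ∫ t in 0..T, (wt L₂ t + a * wx L₂ t + c * w L₂ t) ^ 2 := by
  have h0 := h.cont
  have h1 := h.cont_t
  have h2 := h.cont_x
  have h3 := h.cont_xx
  have toSet : ∀ f : ℝ → ℝ → ℝ, (Continuous fun p : ℝ × ℝ => f p.1 p.2) →
      ∫ t in 0..T, ∫ x in (-L₁)..L₂, f x t = ∫ p in Ioo (-L₁) L₂ ×ˢ Ioo 0 T, f p.1 p.2 :=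
    fun f hf => by
      rw [setIntegral_Ioo_prod_of_continuous hf hL hT, intervalIntegral_swap_of_continuous hf hL hT]
  have b1 := h.integral_wxx_mul_wt_le hL hT
  have b2 := h.integral_wx_sq_le ha hc hν hT hL
  have b3 := h.integral_mul_wt_nonneg hT hL
  rw [toSet (fun x t => wxx x t * wt x t) (by fun_prop)] at b1
  rw [toSet (fun x t => wx x t ^ 2) (by fun_prop)] at b2
  rw [toSet (fun x t => w x t * wt x t) (by fun_prop)] at b3
  set N := ∫ t in 0..T, (wt L₂ t + a * wx L₂ t + c * w L₂ t) ^ 2 with hN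
  have i1 := integrableOn_Ioo_prod_of_continuous (f := fun x t => wxx x t * wt x t) (by fun_prop)
    (-L₁) L₂ 0 T
  have i2 := integrableOn_Ioo_prod_of_continuous (f := fun x t => wx x t ^ 2) (by fun_prop)
    (-L₁) L₂ 0 T
  have i3 := integrableOn_Ioo_prod_of_continuous (f := fun x t => w x t * wt x t) (by fun_prop)
    (-L₁) L₂ 0 T
  have i4 := integrableOn_Ioo_prod_of_continuous (f := fun x t => wt x t ^ 2) (by fun_prop)
    (-L₁) L₂ 0 T
  have main : ∫ p in Ioo (-L₁) L₂ ×ˢ Ioo 0 T, wt p.1 p.2 ^ 2 ≤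
      ∫ p in Ioo (-L₁) L₂ ×ˢ Ioo 0 T, (2 * ν * (wxx p.1 p.2 * wt p.1 p.2)
        - 2 * c * (w p.1 p.2 * wt p.1 p.2) + a ^ 2 * wx p.1 p.2 ^ 2) := by
    refine integral_mono i4 (((i1.const_mul _).sub (i3.const_mul _)).add (i2.const_mul _)) ?_
    intro p
    have e := h.equation p.1 p.2
    -- Young's inequality absorbs the term `2 * a * (wx * wt)` of twice the equation times `wt`.
    have := sq_nonneg (wt p.1 p.2 + a * wx p.1 p.2)
    show wt p.1 p.2 ^ 2 ≤ 2 * ν * (wxx p.1 p.2 * wt p.1 p.2)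
        - 2 * c * (w p.1 p.2 * wt p.1 p.2) + a ^ 2 * wx p.1 p.2 ^ 2
    have e' : 2 * ν * (wxx p.1 p.2 * wt p.1 p.2) = 2 * wt p.1 p.2 ^ 2
        + 2 * a * (wx p.1 p.2 * wt p.1 p.2) + 2 * c * (w p.1 p.2 * wt p.1 p.2) := by
      linear_combination (-2 * wt p.1 p.2) * e
    rw [e']
    linarith
  have i5 : IntegrableOn (fun p : ℝ × ℝ => 2 * ν * (wxx p.1 p.2 * wt p.1 p.2)
      - 2 * c * (w p.1 p.2 * wt p.1 p.2)) (Ioo (-L₁) L₂ ×ˢ Ioo 0 T) :=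
    (i1.const_mul _).sub (i3.const_mul _)
  rw [integral_add i5 (i2.const_mul _),
    integral_sub (i1.const_mul _) (i3.const_mul _), integral_const_mul, integral_const_mul,
    integral_const_mul] at main
  have n1 := h.intervalIntegral_mul_wt_nonneg hT L₂
  have b4 : a * (∫ t in 0..T, wx L₂ t * wt L₂ t) + c * (∫ t in 0..T, w L₂ t * wt L₂ t)
      ≤ 1 / 4 * N := by
    simp only [hN, ← intervalIntegral.integral_const_mul]
    rw [← intervalIntegral.integral_add]
    · refine intervalIntegral.integral_mono hT ?_ ?_ fun t => ?_
      · exact Continuous.intervalIntegrable (by fun_prop) _ _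
      · exact Continuous.intervalIntegrable (by fun_prop) _ _
      -- With `b = a * wx + c * w` this is `b * wt ≤ (wt + b) ^ 2 / 4`.
      · have := sq_nonneg (wt L₂ t - (a * wx L₂ t + c * w L₂ t))
        show a * (wx L₂ t * wt L₂ t) + c * (w L₂ t * wt L₂ t)
          ≤ 1 / 4 * (wt L₂ t + a * wx L₂ t + c * w L₂ t) ^ 2
        linarith
    all_goals exact Continuous.intervalIntegrable (by fun_prop) _ _
  have b5 : (∫ t in 0..T, wx L₂ t * wt L₂ t) ≤ 1 / (4 * a) * N := by
    have : a * (∫ t in 0..T, wx L₂ t * wt L₂ t) ≤ a * (1 / (4 * a) * N) := by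
      calc _ ≤ 1 / 4 * N := by linarith [mul_nonneg hc n1]
        _ = _ := by field_simp
    exact le_of_mul_le_mul_left this ha
  have k1 := mul_le_mul_of_nonneg_left (b1.trans b5) (by positivity : 0 ≤ 2 * ν)
  have k2 := mul_le_mul_of_nonneg_left b2 (by positivity : 0 ≤ a ^ 2)
  have k3 := mul_nonneg (by positivity : 0 ≤ 2 * c) b3
  have k4 : ν / a * N = 2 * ν * (1 / (4 * a) * N) + a ^ 2 * (ν / (2 * a ^ 3) * N) := by
    field_simp
    ring
  linarith

theorem setIntegral_wxx_sq_le (h : IsExtendedSolution a c ν L₁ L₂ T w wt wx wxx) (ha : 0 < a)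
    (hc : 0 ≤ c) (hν : 0 < ν) (hT : 0 ≤ T) (hL : -L₁ ≤ L₂) :
    ∫ p in Ioo (-L₁) L₂ ×ˢ Ioo 0 T, wxx p.1 p.2 ^ 2 ≤
      (9 / (2 * a) + 12 * c ^ 2 * ν ^ 2 / a ^ 5) * ν⁻¹ *
        ∫ t in 0..T, (wt L₂ t + a * wx L₂ t + c * w L₂ t) ^ 2 := by
  have h0 := h.cont
  have h1 := h.cont_t
  have h2 := h.cont_x
  have h3 := h.cont_xx
  have b1 := h.setIntegral_wt_sq_le ha hc hν hT hL
  have b2 := h.integral_wx_sq_le ha hc hν hT hL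
  rw [← intervalIntegral_swap_of_continuous (f := fun x t => wx x t ^ 2) (by fun_prop) hL hT,
    ← setIntegral_Ioo_prod_of_continuous (f := fun x t => wx x t ^ 2) (by fun_prop) hL hT] at b2
  have b3 := h.integral_integral_sq_le ha hc hν hT hL
  rw [← setIntegral_Ioo_prod_of_continuous (f := fun x t => w x t ^ 2) (by fun_prop) hL hT] at b3
  set N := ∫ t in 0..T, (wt L₂ t + a * wx L₂ t + c * w L₂ t) ^ 2 with hN
  have i1 := integrableOn_Ioo_prod_of_continuous (f := fun x t => wt x t ^ 2) (by fun_prop)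
    (-L₁) L₂ 0 T
  have i2 := integrableOn_Ioo_prod_of_continuous (f := fun x t => wx x t ^ 2) (by fun_prop)
    (-L₁) L₂ 0 T
  have i3 := integrableOn_Ioo_prod_of_continuous (f := fun x t => w x t ^ 2) (by fun_prop)
    (-L₁) L₂ 0 T
  have i4 := integrableOn_Ioo_prod_of_continuous (f := fun x t => wxx x t ^ 2) (by fun_prop)
    (-L₁) L₂ 0 T
  have main : ν ^ 2 * ∫ p in Ioo (-L₁) L₂ ×ˢ Ioo 0 T, wxx p.1 p.2 ^ 2 ≤
      ∫ p in Ioo (-L₁) L₂ ×ˢ Ioo 0 T, (3 * wt p.1 p.2 ^ 2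
        + 3 * a ^ 2 * wx p.1 p.2 ^ 2 + 3 * c ^ 2 * w p.1 p.2 ^ 2) := by
    rw [← integral_const_mul]
    refine integral_mono (i4.const_mul _)
      (((i1.const_mul _).add (i2.const_mul _)).add (i3.const_mul _)) ?_
    intro p
    have e := h.equation p.1 p.2
    show ν ^ 2 * wxx p.1 p.2 ^ 2 ≤ 3 * wt p.1 p.2 ^ 2
        + 3 * a ^ 2 * wx p.1 p.2 ^ 2 + 3 * c ^ 2 * w p.1 p.2 ^ 2
    have e' : ν * wxx p.1 p.2 = wt p.1 p.2 + a * wx p.1 p.2 + c * w p.1 p.2 := by linarith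
    rw [← mul_pow, e']
    linarith [sq_nonneg (wt p.1 p.2 - a * wx p.1 p.2), sq_nonneg (wt p.1 p.2 - c * w p.1 p.2),
      sq_nonneg (a * wx p.1 p.2 - c * w p.1 p.2)]
  have i5 : IntegrableOn (fun p : ℝ × ℝ => 3 * wt p.1 p.2 ^ 2 + 3 * a ^ 2 * wx p.1 p.2 ^ 2)
      (Ioo (-L₁) L₂ ×ˢ Ioo 0 T) :=
    (i1.const_mul _).add (i2.const_mul _)
  rw [integral_add i5 (i3.const_mul _),
    integral_add (i1.const_mul _) (i2.const_mul _), integral_const_mul, integral_const_mul,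
    integral_const_mul] at main
  have k1 := mul_le_mul_of_nonneg_left b2 (by positivity : 0 ≤ 3 * a ^ 2)
  have k2 := mul_le_mul_of_nonneg_left b3 (by positivity : 0 ≤ 3 * c ^ 2)
  refine le_of_mul_le_mul_left (a := ν ^ 2) ?_ (by positivity)
  have k4 : ν ^ 2 * ((9 / (2 * a) + 12 * c ^ 2 * ν ^ 2 / a ^ 5) * ν⁻¹ * N)
      = 3 * (ν / a * N) + 3 * a ^ 2 * (ν / (2 * a ^ 3) * N)
        + 3 * c ^ 2 * (4 * ν ^ 3 / a ^ 5 * N) := by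
    field_simp
    ring
  linarith

end IsExtendedSolution

/-! ### Extension from the rectangle to the plane -/

/-- The point of `[A, B]` nearest to `x`, when `A ≤ B`. -/
noncomputable def clamp (A B x : ℝ) : ℝ := max A (min B x)

/-- The extension of `f` from `[-L₁, L₂] × [0, T]` to the plane that takes the value of `f` at the
nearest point of the rectangle. It turns continuity on the rectangle into continuity, and one-sided
derivatives at the edges into values of a continuous function. -/
noncomputable def clampRect (L₁ L₂ T : ℝ) (f : ℝ → ℝ → ℝ) : ℝ → ℝ → ℝ :=
  fun x t => f (clamp (-L₁) L₂ x) (clamp 0 T t)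

theorem continuous_clamp (A B : ℝ) : Continuous (clamp A B) := by
  unfold clamp; fun_prop

theorem clamp_mem {A B : ℝ} (h : A ≤ B) (x : ℝ) : clamp A B x ∈ Icc A B :=
  ⟨le_max_left _ _, max_le h (min_le_left _ _)⟩

theorem clamp_of_mem {A B x : ℝ} (h : x ∈ Icc A B) : clamp A B x = x := by
  rw [clamp, min_eq_right h.2, max_eq_right h.1]

theorem clampRect_of_mem {L₁ L₂ T x t : ℝ} (f : ℝ → ℝ → ℝ) (hx : x ∈ Icc (-L₁) L₂)
    (ht : t ∈ Icc 0 T) : clampRect L₁ L₂ T f x t = f x t := by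
  rw [clampRect, clamp_of_mem hx, clamp_of_mem ht]

theorem eq_zero_of_continuous_clamp {A B : ℝ} (hAB : A < B) {g : ℝ → ℝ}
    (hg : Continuous fun x => g (clamp A B x)) (h : ∀ x ∈ Ioo A B, g x = 0) (x : ℝ) :
    g (clamp A B x) = 0 := by
  have h1 : EqOn (fun x => g (clamp A B x)) (fun _ => 0) (Icc A B) := by
    refine EqOn.of_subset_closure (s := Ioo A B) (fun y hy => ?_) hg.continuousOn
      continuousOn_const Ioo_subset_Icc_self (closure_Ioo hAB.ne).ge
    rw [clamp_of_mem (Ioo_subset_Icc_self hy), h y hy]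
  have := h1 (clamp_mem hAB.le x)
  dsimp only at this
  rwa [clamp_of_mem (clamp_mem hAB.le x)] at this

theorem clampRect_eq_zero {L₁ L₂ T : ℝ} (hL : -L₁ < L₂) (hT : 0 < T) {f : ℝ → ℝ → ℝ}
    (hf : Continuous fun p : ℝ × ℝ => clampRect L₁ L₂ T f p.1 p.2)
    (h : ∀ x ∈ Ioo (-L₁) L₂, ∀ t ∈ Ioo 0 T, f x t = 0) (x t : ℝ) :
    clampRect L₁ L₂ T f x t = 0 := by
  refine eq_zero_of_continuous_clamp hL (g := fun y => f y (clamp 0 T t))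
    (hf.comp (by fun_prop : Continuous fun y : ℝ => (y, t))) (fun y hy => ?_) x
  refine eq_zero_of_continuous_clamp hT (g := f y) ?_ (h y hy) t
  have := hf.comp (by fun_prop : Continuous fun s : ℝ => (y, s))
  simpa only [Function.comp_def, clampRect, clamp_of_mem (Ioo_subset_Icc_self hy)] using this

theorem continuous_clampRect {L₁ L₂ T : ℝ} (hL : -L₁ ≤ L₂) (hT : 0 ≤ T) {f : ℝ → ℝ → ℝ}
    (hf : ContinuousOn (fun p : ℝ × ℝ => f p.1 p.2) (Icc (-L₁) L₂ ×ˢ Icc 0 T)) :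
    Continuous fun p : ℝ × ℝ => clampRect L₁ L₂ T f p.1 p.2 := by
  have h1 := continuous_clamp (-L₁) L₂
  have h2 := continuous_clamp 0 T
  exact hf.comp_continuous
    (by fun_prop : Continuous fun p : ℝ × ℝ => (clamp (-L₁) L₂ p.1, clamp 0 T p.2))
    fun p => ⟨clamp_mem hL _, clamp_mem hT _⟩

theorem hasDerivAt_comp_clamp {A B : ℝ} {g : ℝ → ℝ} (hg : DifferentiableOn ℝ g (Icc A B)) {x : ℝ}
    (hx : x ∈ Ioo A B) :
    HasDerivAt (fun y => g (clamp A B y)) (derivWithin g (Icc A B) (clamp A B x)) x := by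
  have hn : Icc A B ∈ nhds x := Icc_mem_nhds hx.1 hx.2
  rw [clamp_of_mem (Ioo_subset_Icc_self hx)]
  refine ((hg x (Ioo_subset_Icc_self hx)).hasDerivWithinAt.hasDerivAt hn).congr_of_eventuallyEq ?_
  filter_upwards [hn] with y hy
  rw [clamp_of_mem hy]

theorem hasDerivAt_clampRect_time {L₁ L₂ T : ℝ} (hL : -L₁ ≤ L₂) {f : ℝ → ℝ → ℝ}
    (hf : ∀ x ∈ Icc (-L₁) L₂, DifferentiableOn ℝ (fun t => f x t) (Icc 0 T)) (x : ℝ) {t : ℝ}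
    (ht : t ∈ Ioo 0 T) :
    HasDerivAt (fun s => clampRect L₁ L₂ T f x s) (clampRect L₁ L₂ T (timeDeriv T f) x t) t :=
  hasDerivAt_comp_clamp (hf _ (clamp_mem hL x)) ht

theorem hasDerivAt_clampRect_space {L₁ L₂ T : ℝ} (hT : 0 ≤ T) {f : ℝ → ℝ → ℝ}
    (hf : ∀ t ∈ Icc 0 T, DifferentiableOn ℝ (fun x => f x t) (Icc (-L₁) L₂)) {x : ℝ}
    (hx : x ∈ Ioo (-L₁) L₂) (t : ℝ) :
    HasDerivAt (fun y => clampRect L₁ L₂ T f y t)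
      (clampRect L₁ L₂ T (spaceDeriv L₁ L₂ f) x t) x :=
  hasDerivAt_comp_clamp (hf _ (clamp_mem hT t)) hx

/-- If `p = ∂ₓ w` and `q = ∂ₓ ∂ₜ w` are continuous, then `∂ₜ p` exists and equals `q`, also on the
edges `x = A` and `x = B`: differentiate `w(x, t) - w(x, 0) = ∫₀ᵗ ∂ₜ w(x, r) dr` in `x`. -/
theorem hasDerivAt_deriv_comm {A B T : ℝ} (hAB : A < B) {w w' p q : ℝ → ℝ → ℝ}
    (hw : Continuous fun z : ℝ × ℝ => w z.1 z.2) (hw' : Continuous fun z : ℝ × ℝ => w' z.1 z.2)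
    (hp : Continuous fun z : ℝ × ℝ => p z.1 z.2) (hq : Continuous fun z : ℝ × ℝ => q z.1 z.2)
    (hwt : ∀ x, ∀ t ∈ Ioo 0 T, HasDerivAt (fun s => w x s) (w' x t) t)
    (hwx : ∀ x ∈ Ioo A B, ∀ t, HasDerivAt (fun y => w y t) (p x t) x)
    (hwx' : ∀ x ∈ Ioo A B, ∀ t, HasDerivAt (fun y => w' y t) (q x t) x)
    {x t : ℝ} (hx : x ∈ Icc A B) (ht : t ∈ Ioo 0 T) :
    HasDerivAt (fun s => p x s) (q x t) t := by
  have key : ∀ s ∈ Ioo 0 T, p x s = p x 0 + ∫ r in 0..s, q x r := by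
    intro s hs
    refine EqOn.of_subset_closure (s := Ioo A B) (t := Icc A B) (f := fun x => p x s)
      (g := fun x => p x 0 + ∫ r in 0..s, q x r) (fun y hy => ?_) ?_ ?_
      Ioo_subset_Icc_self (closure_Ioo hAB.ne).ge hx
    · have d1 : HasDerivAt (fun z => w z s - w z 0) (p y s - p y 0) y :=
        (hwx y hy s).sub (hwx y hy 0)
      have d2 := hasDerivAt_intervalIntegral_param 0 s hw' hq hwx' hy
      have e : (fun z => ∫ r in 0..s, w' z r) = fun z => w z s - w z 0 := by
        ext z
        exact intervalIntegral_eq_sub_of_continuous hs.1.le (by fun_prop) (by fun_prop)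
          fun r hr => hwt z r ⟨hr.1, hr.2.trans hs.2⟩
      rw [e] at d2
      have := d1.unique d2
      show p y s = p y 0 + ∫ r in 0..s, q y r
      linarith
    · exact Continuous.continuousOn (by fun_prop)
    · exact Continuous.continuousOn (by fun_prop)
  have hqx : Continuous fun r => q x r := by fun_prop
  refine ((hqx.integral_hasStrictDerivAt 0 t).hasDerivAt.const_add (p x 0)).congr_of_eventuallyEq ?_
  filter_upwards [Ioo_mem_nhds ht.1 ht.2] with s hs using key s hs

/-! ### The time derivatives of a solution -/

namespace IsAdvDiffSolution
variable {a c ν L₁ L₂ T : ℝ} {g₂ : ℝ → ℝ} {γ : ℕ} {u : ℝ → ℝ → ℝ}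

theorem hasDerivAt_time (h : IsAdvDiffSolution a c ν L₁ L₂ T (fun _ _ => 0) (fun _ => 0) g₂
    (fun _ => 0) γ u) (hL : -L₁ < L₂) {j : ℕ} (hj : j ≤ γ) (x : ℝ) {t : ℝ} (ht : t ∈ Ioo 0 T) :
    HasDerivAt (fun s => clampRect L₁ L₂ T ((timeDeriv T)^[j] u) x s)
      (clampRect L₁ L₂ T ((timeDeriv T)^[j + 1] u) x t) t := by
  rw [Function.iterate_succ_apply']
  exact hasDerivAt_clampRect_time hL.le (h.regular j hj).diff_t x ht

theorem hasDerivAt_time_spaceDeriv (h : IsAdvDiffSolution a c ν L₁ L₂ T (fun _ _ => 0)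
    (fun _ => 0) g₂ (fun _ => 0) γ u) (hL : -L₁ < L₂) (hT : 0 < T) {j : ℕ} (hj : j + 1 ≤ γ)
    {x t : ℝ} (hx : x ∈ Icc (-L₁) L₂) (ht : t ∈ Ioo 0 T) :
    HasDerivAt (fun s => clampRect L₁ L₂ T (spaceDeriv L₁ L₂ ((timeDeriv T)^[j] u)) x s)
      (clampRect L₁ L₂ T (spaceDeriv L₁ L₂ ((timeDeriv T)^[j + 1] u)) x t) t := by
  have r0 := h.regular j (by omega)
  have r1 := h.regular (j + 1) hj
  exact hasDerivAt_deriv_comm hL (continuous_clampRect hL.le hT.le r0.cont)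
    (continuous_clampRect hL.le hT.le r1.cont) (continuous_clampRect hL.le hT.le r0.cont_x)
    (continuous_clampRect hL.le hT.le r1.cont_x)
    (fun x t ht => h.hasDerivAt_time hL (by omega) x ht)
    (fun x hx t => hasDerivAt_clampRect_space hT.le r0.diff_x hx t)
    (fun x hx t => hasDerivAt_clampRect_space hT.le r1.diff_x hx t) hx ht

theorem hasDerivAt_time_spaceDeriv_spaceDeriv (h : IsAdvDiffSolution a c ν L₁ L₂ T (fun _ _ => 0)
    (fun _ => 0) g₂ (fun _ => 0) γ u) (hL : -L₁ < L₂) (hT : 0 < T) {j : ℕ} (hj : j + 1 ≤ γ)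
    {x t : ℝ} (hx : x ∈ Icc (-L₁) L₂) (ht : t ∈ Ioo 0 T) :
    HasDerivAt (fun s => clampRect L₁ L₂ T
        (spaceDeriv L₁ L₂ (spaceDeriv L₁ L₂ ((timeDeriv T)^[j] u))) x s)
      (clampRect L₁ L₂ T
        (spaceDeriv L₁ L₂ (spaceDeriv L₁ L₂ ((timeDeriv T)^[j + 1] u))) x t) t := by
  have r0 := h.regular j (by omega)
  have r1 := h.regular (j + 1) hj
  refine hasDerivAt_deriv_comm hL (continuous_clampRect hL.le hT.le r0.cont_x)
    (continuous_clampRect hL.le hT.le r1.cont_x) (continuous_clampRect hL.le hT.le r0.cont_xx)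
    (continuous_clampRect hL.le hT.le r1.cont_xx) (fun x t ht => ?_)
    (fun x hx t => hasDerivAt_clampRect_space hT.le r0.diff_xx hx t)
    (fun x hx t => hasDerivAt_clampRect_space hT.le r1.diff_xx hx t) hx ht
  have := h.hasDerivAt_time_spaceDeriv hL hT hj (clamp_mem hL.le x) ht
  simpa only [clampRect, clamp_of_mem (clamp_mem hL.le x)] using this

/-- Every time derivative of order `j ≤ γ` again solves the homogeneous problem. By induction, the
equation and the inflow condition can be differentiated in time; the initial condition for
`∂ₜʲ⁺¹ u` is the equation for `∂ₜʲ u` at `t = 0`. -/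
theorem isExtendedSolution (h : IsAdvDiffSolution a c ν L₁ L₂ T (fun _ _ => 0)
    (fun _ => 0) g₂ (fun _ => 0) γ u) (hL : -L₁ < L₂) (hT : 0 < T) {j : ℕ} (hj : j ≤ γ) :
    IsExtendedSolution a c ν L₁ L₂ T (clampRect L₁ L₂ T ((timeDeriv T)^[j] u))
      (clampRect L₁ L₂ T ((timeDeriv T)^[j + 1] u))
      (clampRect L₁ L₂ T (spaceDeriv L₁ L₂ ((timeDeriv T)^[j] u)))
      (clampRect L₁ L₂ T (spaceDeriv L₁ L₂ (spaceDeriv L₁ L₂ ((timeDeriv T)^[j] u)))) := by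
  have r := h.regular j hj
  have c0 := continuous_clampRect hL.le hT.le r.cont
  have c1 : Continuous fun p : ℝ × ℝ => clampRect L₁ L₂ T ((timeDeriv T)^[j + 1] u) p.1 p.2 := by
    rw [Function.iterate_succ_apply']
    exact continuous_clampRect hL.le hT.le r.cont_t
  have c2 := continuous_clampRect hL.le hT.le r.cont_x
  have c3 := continuous_clampRect hL.le hT.le r.cont_xx
  have heq : Continuous fun p : ℝ × ℝ => clampRect L₁ L₂ T (fun x t =>
      (timeDeriv T)^[j + 1] u x t
        - ν * spaceDeriv L₁ L₂ (spaceDeriv L₁ L₂ ((timeDeriv T)^[j] u)) x t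
        + a * spaceDeriv L₁ L₂ ((timeDeriv T)^[j] u) x t + c * (timeDeriv T)^[j] u x t) p.1 p.2 :=
    ((c1.sub (c3.const_mul ν)).add (c2.const_mul a)).add (c0.const_mul c)
  have hl : Continuous fun t => (timeDeriv T)^[j] u (-L₁) (clamp 0 T t) := by
    have := c0.comp (by fun_prop : Continuous fun t : ℝ => (-L₁, t))
    simpa only [Function.comp_def, clampRect, clamp_of_mem (left_mem_Icc.2 hL.le)] using this
  have hi : Continuous fun x => (timeDeriv T)^[j] u (clamp (-L₁) L₂ x) 0 := by
    have := c0.comp (by fun_prop : Continuous fun x : ℝ => (x, (0 : ℝ)))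
    simpa only [Function.comp_def, clampRect, clamp_of_mem (left_mem_Icc.2 hT.le)] using this
  refine ⟨c0, c1, c2, c3, fun x t ht => h.hasDerivAt_time hL hj x ht,
    fun x hx t => hasDerivAt_clampRect_space hT.le r.diff_x hx t,
    fun x hx t => hasDerivAt_clampRect_space hT.le r.diff_xx hx t, ?_, ?_, ?_⟩
  · refine clampRect_eq_zero hL hT heq fun x hx t ht => ?_
    cases j with
    | zero => exact h.equation x hx t ht
    | succ j =>
      have hd := h.isExtendedSolution hL hT (j := j) (by omega)
      have hx' := Ioo_subset_Icc_self hx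
      have ht' := Ioo_subset_Icc_self ht
      have d := (((h.hasDerivAt_time hL hj x ht).sub
        ((h.hasDerivAt_time_spaceDeriv_spaceDeriv hL hT hj hx' ht).const_mul ν)).add
        ((h.hasDerivAt_time_spaceDeriv hL hT hj hx' ht).const_mul a)).add
        ((h.hasDerivAt_time hL (j := j) (by omega) x ht).const_mul c)
      have e := d.unique ((hasDerivAt_const t (0 : ℝ)).congr_of_eventuallyEq
        (Filter.Eventually.of_forall fun s => hd.equation x s))
      simpa only [clampRect_of_mem _ hx' ht'] using e
  · intro t
    simp only [clampRect, clamp_of_mem (left_mem_Icc.2 hL.le)]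
    refine eq_zero_of_continuous_clamp hT hl (fun s hs => ?_) t
    cases j with
    | zero => exact h.left s hs
    | succ j =>
      have := (h.isExtendedSolution hL hT (j := j) (by omega)).left_t hs
      rwa [clampRect_of_mem _ (left_mem_Icc.2 hL.le) (Ioo_subset_Icc_self hs)] at this
  · intro x
    simp only [clampRect, clamp_of_mem (left_mem_Icc.2 hT.le)]
    refine eq_zero_of_continuous_clamp hL
      (g := fun x => (timeDeriv T)^[j] u x 0) hi (fun y hy => ?_) x
    cases j with
    | zero => exact h.initial y hy
    | succ j =>
      have hd := h.isExtendedSolution hL hT (j := j) (by omega)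
      have e := hd.equation y 0
      rw [hd.initial_x hy, hd.initial_xx hy, hd.initial,
        clampRect_of_mem _ (Ioo_subset_Icc_self hy) (left_mem_Icc.2 hT.le)] at e
      linarith

/-- The outflow datum of `∂ₜʲ u` is the `j`-th derivative of `g₂`. -/
theorem iteratedDerivWithin_eq (h : IsAdvDiffSolution a c ν L₁ L₂ T (fun _ _ => 0)
    (fun _ => 0) g₂ (fun _ => 0) γ u) (hL : -L₁ < L₂) (hT : 0 < T) {j : ℕ} (hj : j ≤ γ) :
    ∀ t ∈ Ioo 0 T, iteratedDerivWithin j g₂ (Ioc 0 T) t =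
      clampRect L₁ L₂ T ((timeDeriv T)^[j + 1] u) L₂ t
        + a * clampRect L₁ L₂ T (spaceDeriv L₁ L₂ ((timeDeriv T)^[j] u)) L₂ t
        + c * clampRect L₁ L₂ T ((timeDeriv T)^[j] u) L₂ t := by
  have hx : L₂ ∈ Icc (-L₁) L₂ := right_mem_Icc.2 hL.le
  induction j with
  | zero =>
    intro t ht
    simp only [clampRect_of_mem _ hx (Ioo_subset_Icc_self ht), iteratedDerivWithin_zero]
    exact (h.right t ht).symm
  | succ j ih =>
    intro t ht
    rw [iteratedDerivWithin_succ, derivWithin_of_mem_nhds (Ioc_mem_nhds ht.1 ht.2)]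
    have d := ((h.hasDerivAt_time hL hj L₂ ht).add
      ((h.hasDerivAt_time_spaceDeriv hL hT hj hx ht).const_mul a)).add
      ((h.hasDerivAt_time hL (j := j) (by omega) L₂ ht).const_mul c)
    refine (d.congr_of_eventuallyEq ?_).deriv
    filter_upwards [Ioo_mem_nhds ht.1 ht.2] with s hs using ih (by omega) s hs

end IsAdvDiffSolution

/-! ### Norms -/

theorem eLpNorm_two_eq_ofReal_sqrt {α : Type*} [MeasurableSpace α] {μ : Measure α} {f : α → ℝ}
    (hf : AEStronglyMeasurable f μ) (hi : Integrable (fun x => f x ^ 2) μ) :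
    eLpNorm f 2 μ = ENNReal.ofReal (√(∫ x, f x ^ 2 ∂μ)) := by
  rw [((memLp_two_iff_integrable_sq hf).2 hi).eLpNorm_eq_integral_rpow_norm (by norm_num)
    (by norm_num), Real.sqrt_eq_rpow]
  simp

theorem eLpNorm_two_le_of_integral_sq_le {α β : Type*} [MeasurableSpace α] [MeasurableSpace β]
    {μ : Measure α} {μ' : Measure β} {f : α → ℝ} {g : β → ℝ}
    (hf : AEStronglyMeasurable f μ) (hfi : Integrable (fun x => f x ^ 2) μ)
    (hg : AEStronglyMeasurable g μ') (hgi : Integrable (fun x => g x ^ 2) μ')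
    {κ : ℝ} (hκ : 0 ≤ κ) (h : ∫ x, f x ^ 2 ∂μ ≤ κ ^ 2 * ∫ x, g x ^ 2 ∂μ') :
    eLpNorm f 2 μ ≤ ENNReal.ofReal κ * eLpNorm g 2 μ' := by
  rw [eLpNorm_two_eq_ofReal_sqrt hf hfi, eLpNorm_two_eq_ofReal_sqrt hg hgi,
    ← ENNReal.ofReal_mul hκ]
  refine ENNReal.ofReal_le_ofReal ((Real.sqrt_le_sqrt h).trans_eq ?_)
  rw [Real.sqrt_mul (sq_nonneg κ), Real.sqrt_sq hκ]

theorem normL2t_iteratedDerivWithin_le_normHt (T : ℝ) (k : ℕ) (g : ℝ → ℝ) :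
    normL2t T (iteratedDerivWithin k g (Ioc 0 T)) ≤ normHt T k g := by
  have h := Finset.single_le_sum (f := fun j => normL2t T (iteratedDerivWithin j g (Ioc 0 T)) ^ 2)
    (fun _ _ => zero_le) (Finset.self_mem_range_succ k)
  have h2 := ENNReal.rpow_le_rpow h (by norm_num : (0 : ℝ) ≤ 1 / 2)
  refine le_trans (le_of_eq ?_) h2
  rw [← ENNReal.rpow_natCast, ← ENNReal.rpow_mul]
  norm_num

theorem lemma3p2 (a c L₁ L₂ T : ℝ) (ha : 0 < a) (hc : 0 < c) (hL₁ : 0 < L₁) (hL₂ : 0 < L₂)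
    (hT : 0 < T) :
    ∃ νbar > (0 : ℝ), ∃ C > (0 : ℝ), ∀ ν : ℝ, 0 < ν → ν ≤ νbar →
      ∀ g₂ : ℝ → ℝ, IsSmoothCompactIoc T g₂ →
      ∀ (γ : ℕ) (u₂ : ℝ → ℝ → ℝ),
        IsAdvDiffSolution a c ν L₁ L₂ T (fun _ _ => 0) (fun _ => 0) g₂ (fun _ => 0) γ u₂ →
      ∀ k ≤ γ,
        (∀ x ∈ Set.Icc (-L₁) L₂,
          normL2t T (fun t => (timeDeriv T)^[k] u₂ x t)
            ≤ ENNReal.ofReal (C * ν) * normHt T k g₂) ∧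
        normL2xt L₁ L₂ T ((timeDeriv T)^[k] u₂)
          ≤ ENNReal.ofReal (C * ν ^ (3 / 2 : ℝ)) * normHt T k g₂ ∧
        normL2xt L₁ L₂ T (spaceDeriv L₁ L₂ ((timeDeriv T)^[k] u₂))
          ≤ ENNReal.ofReal (C * ν ^ (1 / 2 : ℝ)) * normHt T k g₂ ∧
        normL2xt L₁ L₂ T (spaceDeriv L₁ L₂ (spaceDeriv L₁ L₂ ((timeDeriv T)^[k] u₂)))
          ≤ ENNReal.ofReal (C * ν ^ (-(1 / 2) : ℝ)) * normHt T k g₂ := by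
  set K : ℝ := 4 / a ^ 4 + 4 / a ^ 5 + 1 / (2 * a ^ 3) + (9 / (2 * a) + 12 * c ^ 2 / a ^ 5) with hK
  have hK1 : 4 / a ^ 4 ≤ K := by
    have : 0 ≤ 4 / a ^ 5 + 1 / (2 * a ^ 3) + (9 / (2 * a) + 12 * c ^ 2 / a ^ 5) := by positivity
    linarith
  have hK2 : 4 / a ^ 5 ≤ K := by
    have : 0 ≤ 4 / a ^ 4 + 1 / (2 * a ^ 3) + (9 / (2 * a) + 12 * c ^ 2 / a ^ 5) := by positivity
    linarith
  have hK3 : 1 / (2 * a ^ 3) ≤ K := by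
    have : 0 ≤ 4 / a ^ 4 + 4 / a ^ 5 + (9 / (2 * a) + 12 * c ^ 2 / a ^ 5) := by positivity
    linarith
  have hK4 : 9 / (2 * a) + 12 * c ^ 2 / a ^ 5 ≤ K := by
    have : 0 ≤ 4 / a ^ 4 + 4 / a ^ 5 + 1 / (2 * a ^ 3) := by positivity
    linarith
  have hK0 : 0 < K := lt_of_lt_of_le (by positivity) hK1
  -- The bound `ν ≤ 1` is only used to drop a factor `ν ^ 2` in the estimate of `wxx`.
  refine ⟨1, one_pos, √K, Real.sqrt_pos.2 hK0, ?_⟩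
  intro ν hν hν1 g₂ _ γ u₂ h k hk
  have hL : -L₁ < L₂ := by linarith
  have d := h.isExtendedSolution hL hT hk
  set w := clampRect L₁ L₂ T ((timeDeriv T)^[k] u₂) with hw
  set wt := clampRect L₁ L₂ T ((timeDeriv T)^[k + 1] u₂) with hwt
  set wx := clampRect L₁ L₂ T (spaceDeriv L₁ L₂ ((timeDeriv T)^[k] u₂)) with hwx
  set wxx := clampRect L₁ L₂ T (spaceDeriv L₁ L₂ (spaceDeriv L₁ L₂ ((timeDeriv T)^[k] u₂)))
    with hwxx
  have h0 := d.cont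
  have h1 := d.cont_t
  have h2 := d.cont_x
  have h3 := d.cont_xx
  set g : ℝ → ℝ := fun t => wt L₂ t + a * wx L₂ t + c * w L₂ t with hg
  have hgc : Continuous g := by fun_prop
  set N := ∫ t in 0..T, g t ^ 2 with hN
  have hN0 : 0 ≤ N := intervalIntegral.integral_nonneg hT.le fun t _ => sq_nonneg _
  have hNs : N = ∫ t in Ioo 0 T, g t ^ 2 := by
    rw [hN, intervalIntegral.integral_of_le hT.le, integral_Ioc_eq_integral_Ioo]
  have hgN : eLpNorm g 2 (volume.restrict (Ioo 0 T)) ≤ normHt T k g₂ := by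
    refine le_trans (le_of_eq (eLpNorm_congr_ae ?_))
      (normL2t_iteratedDerivWithin_le_normHt T k g₂)
    exact ae_restrict_of_forall_mem measurableSet_Ioo
      fun t ht => (h.iteratedDerivWithin_eq hL hT hk t ht).symm
  have int1 : ∀ f : ℝ → ℝ, Continuous f → IntegrableOn (fun t => f t ^ 2) (Ioo 0 T) :=
    fun f hf => ((hf.pow 2).continuousOn.integrableOn_compact isCompact_Icc).mono_set
      Ioo_subset_Icc_self
  -- A bound of an integral by `K * ν ^ (2 * e) * N` is a bound of the norm with exponent `e`.
  have norm_le : ∀ (f : ℝ → ℝ → ℝ) (e : ℝ),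
      (Continuous fun p : ℝ × ℝ => clampRect L₁ L₂ T f p.1 p.2) →
      ∫ p in Ioo (-L₁) L₂ ×ˢ Ioo 0 T, clampRect L₁ L₂ T f p.1 p.2 ^ 2 ≤ K * ν ^ (2 * e) * N →
      normL2xt L₁ L₂ T f ≤ ENNReal.ofReal (√K * ν ^ e) * normHt T k g₂ := by
    intro f e hf hle
    have hcongr : normL2xt L₁ L₂ T f
        = eLpNorm (fun p : ℝ × ℝ => clampRect L₁ L₂ T f p.1 p.2) 2
          (volume.restrict (Ioo (-L₁) L₂ ×ˢ Ioo 0 T)) := by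
      refine eLpNorm_congr_ae (ae_restrict_of_forall_mem
        (measurableSet_Ioo.prod measurableSet_Ioo) fun p hp => ?_)
      exact (clampRect_of_mem f (Ioo_subset_Icc_self hp.1) (Ioo_subset_Icc_self hp.2)).symm
    rw [hcongr]
    refine (eLpNorm_two_le_of_integral_sq_le hf.aestronglyMeasurable
      (integrableOn_Ioo_prod_of_continuous
        (f := fun x t => clampRect L₁ L₂ T f x t ^ 2) (hf.pow 2) _ _ _ _)
      hgc.aestronglyMeasurable (int1 g hgc) (by positivity) ?_).trans
      (mul_le_mul_right hgN _)
    rw [← hNs, mul_pow, Real.sq_sqrt hK0.le, ← Real.rpow_natCast, ← Real.rpow_mul hν.le]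
    rwa [mul_comm e]
  refine ⟨fun x hx => ?_, norm_le _ _ h0 ?_, norm_le _ _ h2 ?_, norm_le _ _ h3 ?_⟩
  · have hcongr : normL2t T (fun t => (timeDeriv T)^[k] u₂ x t)
        = eLpNorm (w x) 2 (volume.restrict (Ioo 0 T)) := by
      refine eLpNorm_congr_ae (ae_restrict_of_forall_mem measurableSet_Ioo fun t ht => ?_)
      exact (clampRect_of_mem _ hx (Ioo_subset_Icc_self ht)).symm
    have hwc : Continuous (w x) := by fun_prop
    rw [hcongr]
    refine (eLpNorm_two_le_of_integral_sq_le hwc.aestronglyMeasurable (int1 _ hwc)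
      hgc.aestronglyMeasurable (int1 g hgc) (by positivity) ?_).trans
      (mul_le_mul_right hgN _)
    rw [← hNs, mul_pow, Real.sq_sqrt hK0.le, ← integral_Ioc_eq_integral_Ioo,
      ← intervalIntegral.integral_of_le hT.le]
    have hexp : Real.exp (-(a / ν) * (L₂ - x)) ≤ 1 := by
      rw [Real.exp_le_one_iff, neg_mul, neg_nonpos]
      exact mul_nonneg (by positivity) (by linarith [hx.2])
    calc _ ≤ _ := d.integral_sq_le ha hc.le hν hT.le hx
      _ ≤ 1 * (4 * ν ^ 2 / a ^ 4 * N) := by gcongr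
      _ = 4 / a ^ 4 * ν ^ 2 * N := by ring
      _ ≤ K * ν ^ 2 * N := by gcongr
  · have := d.integral_integral_sq_le ha hc.le hν hT.le hL.le
    rw [← setIntegral_Ioo_prod_of_continuous (f := fun x t => w x t ^ 2) (by fun_prop)
      hL.le hT.le] at this
    calc _ ≤ _ := this
      _ = 4 / a ^ 5 * ν ^ 3 * N := by ring
      _ ≤ K * ν ^ 3 * N := by gcongr
      _ = K * ν ^ (2 * (3 / 2) : ℝ) * N := by norm_num
  · have := d.integral_wx_sq_le ha hc.le hν hT.le hL.le
    rw [← intervalIntegral_swap_of_continuous (f := fun x t => wx x t ^ 2) (by fun_prop)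
      hL.le hT.le, ← setIntegral_Ioo_prod_of_continuous (f := fun x t => wx x t ^ 2)
      (by fun_prop) hL.le hT.le] at this
    calc _ ≤ _ := this
      _ = 1 / (2 * a ^ 3) * ν * N := by ring
      _ ≤ K * ν * N := by gcongr
      _ = K * ν ^ (2 * (1 / 2) : ℝ) * N := by norm_num
  · calc _ ≤ _ := d.setIntegral_wxx_sq_le ha hc.le hν hT.le hL.le
      _ ≤ (9 / (2 * a) + 12 * c ^ 2 * 1 / a ^ 5) * ν⁻¹ * N := by
        gcongr
        exact pow_le_one₀ hν.le hν1
      _ = (9 / (2 * a) + 12 * c ^ 2 / a ^ 5) * ν⁻¹ * N := by rw [mul_one]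
      _ ≤ K * ν⁻¹ * N := by gcongr
      _ = K * ν ^ (2 * (-(1 / 2)) : ℝ) * N := by
        rw [← Real.rpow_neg_one]
        norm_num
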